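/- Let $\textbf{v}\in\mathbb{R}^3$ with $|\textbf{v}|=1$, $\lambda\in\mathbb{R}$, $\phi(x)=\langle x,\textbf{v}\rangle$ and $dA_\phi=e^{\phi}\,dA$. A translating $\lambda$-soliton is a smooth surface $\Sigma\subset\mathbb{R}^3$, possibly with boundary, oriented by a Gauss map $N$, whose mean curvature $H$ (the sum of the principal curvatures with respect to $N$) satisfies $H=\langle N,\textbf{v}\rangle+\lambda$. Let $\nabla$ and $\Delta$ be the gradient and the Laplace-Beltrami operator of $\Sigma$, let $A$ be its second fundamental form, and let $C_0^\infty(\Sigma)$ be the set of smooth functions on $\Sigma$ with compact support that vanish on $\partial\Sigma$. For $u\in C_0^\infty(\Sigma)$ put $$L_\phi[u]=\Delta u+\langle\nabla u,\textbf{v}\rangle+|A|^2u,\qquad Q_\phi(u)=-\int_\Sigma u\,L_\phi[u]\,dA_\phi .$$ The surface $\Sigma$ is called strongly stable if $Q_\phi(u)\ge 0$ for all $u\in C_0^\infty(\Sigma)$. Theorem. Let $\Sigma$ be a translating $\lambda$-soliton that is the graph, over a domain of some plane of $\mathbb{R}^3$ (the domain may contain boundary points), of a smooth function. Then $\Sigma$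 is strongly stable. Moreover, for every $u\in C_0^\infty(\Sigma)$ the integrals below converge and $$Q_\phi(u)=\int_\Sigma\left(|\nabla u|^2-|A|^2u^2\right)dA_\phi\ \ge\ 0 .$$ -/

import Mathlib

open scoped ContDiff RealInnerProductSpace

noncomputable section

namespace LambdaSoliton

/-- The parameter plane. -/
abbrev E2 := EuclideanSpace ℝ (Fin 2)

/-- Euclidean `3`-space. -/
abbrev E3 := EuclideanSpace ℝ (Fin 3)

/-- Parameter domains of surfaces, possibly with boundary. The set `D` may contain some, all or
none of its frontier points: the points of `D ∩ frontier D` parametrize the boundary `∂Σ` of the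
surface, which has to be negligible for the area. Every open set is allowed (`∂Σ = ∅`), and so
is, for instance, a closed disc or a closed rectangle. No connectedness is required. -/
structure IsParameterDomain (D : Set E2) : Prop where
  subset_closure_interior : D ⊆ closure (interior D)
  boundary_null : MeasureTheory.volume (D ∩ frontier D) = 0

/-- `F` is smooth on `D` (up to the boundary points that belong to `D`): it is `C^∞` on some open
set that contains `D`. -/
def SmoothNear {G : Type*} [NormedAddCommGroup G] [NormedSpace ℝ G] (D : Set E2) (F : E2 → G) :
    Prop :=
  ∃ V : Set E2, IsOpen V ∧ D ⊆ V ∧ ContDiffOn ℝ ∞ F V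

/-- The partial derivative `∂ᵢ F`. -/
def pd {G : Type*} [NormedAddCommGroup G] [NormedSpace ℝ G] (i : Fin 2) (F : E2 → G) (y : E2) :
    G :=
  fderiv ℝ F y (EuclideanSpace.single i 1)

/-- The first fundamental form `gᵢⱼ = ⟨∂ᵢX, ∂ⱼX⟩` of the parametrized surface `X`. -/
def firstForm (X : E2 → E3) (y : E2) : Matrix (Fin 2) (Fin 2) ℝ :=
  Matrix.of fun i j => ⟪pd i X y, pd j X y⟫

/-- The second fundamental form `hᵢⱼ = ⟨∂ᵢ∂ⱼX, N⟩` of `X` with respect to the Gauss map `N`. -/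
def secondForm (X N : E2 → E3) (y : E2) : Matrix (Fin 2) (Fin 2) ℝ :=
  Matrix.of fun i j => ⟪pd i (pd j X) y, N y⟫

/-- The matrix `g⁻¹ h` of the shape operator in the basis `∂₀X, ∂₁X`; its eigenvalues are the
principal curvatures. -/
def shapeOperator (X N : E2 → E3) (y : E2) : Matrix (Fin 2) (Fin 2) ℝ :=
  (firstForm X y)⁻¹ * secondForm X N y

/-- The mean curvature `H`, the sum of the principal curvatures. -/
def meanCurvature (X N : E2 → E3) (y : E2) : ℝ :=
  (shapeOperator X N y).trace

/-- The squared norm `|A|²` of the second fundamental form, that is the sum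
`gⁱᵏ gʲˡ hᵢⱼ hₖₗ` or the sum of the squares of the principal curvatures. -/
def normSqA (X N : E2 → E3) (y : E2) : ℝ :=
  (shapeOperator X N y * shapeOperator X N y).trace

/-- The gradient `∇u = gⁱʲ ∂ⱼu ∂ᵢX` on the surface, a tangent vector in `ℝ³`. -/
def grad (X : E2 → E3) (u : E2 → ℝ) (y : E2) : E3 :=
  ∑ i, ∑ j, ((firstForm X y)⁻¹ i j * pd j u y) • pd i X y

/-- The density `√(det g)` of the area element `dA` in the coordinates `y`. -/
def areaDensity (X : E2 → E3) (y : E2) : ℝ :=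
  √(firstForm X y).det

/-- The Laplace-Beltrami operator `Δu = (det g)^(-1/2) ∂ᵢ((det g)^(1/2) gⁱʲ ∂ⱼu)`. -/
def laplaceBeltrami (X : E2 → E3) (u : E2 → ℝ) (y : E2) : ℝ :=
  (areaDensity X y)⁻¹ *
    ∑ i, pd i (fun z => areaDensity X z * ∑ j, (firstForm X z)⁻¹ i j * pd j u z) y

/-- The density in the coordinates `y` of the weighted area element `dA_φ = e^φ dA`, for
`φ(x) = ⟨x, v⟩`. -/
def weightedAreaDensity (v : E3) (X : E2 → E3) (y : E2) : ℝ :=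
  Real.exp ⟪X y, v⟫ * areaDensity X y

/-- `N` is a Gauss map (an orientation) of the surface `X` over `D`: a continuous unit normal
field. -/
structure IsGaussMap (D : Set E2) (X N : E2 → E3) : Prop where
  continuousOn : ContinuousOn N D
  norm_eq_one : ∀ y ∈ D, ‖N y‖ = 1
  normal : ∀ y ∈ D, ∀ i, ⟪N y, pd i X y⟫ = 0

/-- The surface `X : D → ℝ³`, oriented by `N`, is a translating `lam`-soliton with density
vector `v`: a smooth oriented surface with `H = ⟨N, v⟩ + lam`, where `|v| = 1`. -/
structure IsTranslatingSoliton (v : E3) (lam : ℝ) (D : Set E2) (X N : E2 → E3) : Prop where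
  norm_v : ‖v‖ = 1
  domain : IsParameterDomain D
  smooth : SmoothNear D X
  immersion : ∀ y ∈ D, LinearIndependent ℝ fun i => pd i X y
  gauss : IsGaussMap D X N
  soliton : ∀ y ∈ D, meanCurvature X N y = ⟪N y, v⟫ + lam

/-- The class `C₀^∞(Σ)` in the parameter domain: smooth functions on `D` with compact support
in `D` that vanish on the boundary `∂Σ`. If `D` is open, these are the smooth functions with
compact support in `D`. -/
structure IsTestFunction (D : Set E2) (u : E2 → ℝ) : Prop where
  smooth : SmoothNear D u
  compact_support : ∃ K ⊆ D, IsCompact K ∧ ∀ y ∈ D \ K, u y = 0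
  boundary : ∀ y ∈ D ∩ frontier D, u y = 0

/-- The stability operator `L_φ[u] = Δu + ⟨∇u, v⟩ + |A|² u`. -/
def stabilityOperator (v : E3) (X N : E2 → E3) (u : E2 → ℝ) (y : E2) : ℝ :=
  laplaceBeltrami X u y + ⟪grad X u y, v⟫ + normSqA X N y * u y

/-- The quadratic form `Q_φ(u) = -∫_Σ u L_φ[u] dA_φ` of the second variation. -/
def Qphi (v : E3) (D : Set E2) (X N : E2 → E3) (u : E2 → ℝ) : ℝ :=
  -∫ y in D, u y * stabilityOperator v X N u y * weightedAreaDensity v X y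

/-- Strong stability: `Q_φ(u) ≥ 0` for every test function `u`, without the restriction
`∫ u dA_φ = 0`. -/
def StronglyStable (v : E3) (D : Set E2) (X N : E2 → E3) : Prop :=
  ∀ u : E2 → ℝ, IsTestFunction D u → 0 ≤ Qphi v D X N u

/-- The graph of `f` over the plane spanned by `b 0` and `b 1`, in the direction of its unit
normal `b 2`. -/
def graphMap (b : OrthonormalBasis (Fin 3) ℝ E3) (f : E2 → ℝ) (y : E2) : E3 :=
  y 0 • b 0 + y 1 • b 1 + f y • b 2

end LambdaSoliton

end

/-! Write w = 1 + |∇f|² and div_φ Y = e^(-φ) div(e^φ Y). The angle function ⟨N, `b 2`⟩ of a graph is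
±w^(-1/2), so it has no zeros. Translations along `b 2` preserve the soliton equation, hence n =
w^(-1/2) satisfies the Jacobi equation L_φ[n] = 0, and a positive Jacobi function forces stability.

Concretely, Y = ∇ log n = -∇w / (2w) satisfies div_φ Y = -|A|² - |Y|². Completing the square gives
|∇u|² - |A|²u² = div_φ(u²Y) + |∇u - uY|², which yields `divergence_angleFlux_le`. The divergence
integrates to zero because u vanishes on the boundary and has compact support, so the energy is
nonnegative. In the same way u L_φ[u] = div_φ(u∇u) - (|∇u|² - |A|²u²), which is
`energy_density_eq_divergence_sub`, gives the formula for Q_φ.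

In graph coordinates all of this is explicit in the partial derivatives of f. The Jacobi equation
becomes the polynomial identity `jacobi_identity_jet`, a combination of the two first derivatives of
the soliton equation.

The frontier of the domain has no regularity. `integral_pd_eq_zero` therefore extends a flux
component by zero: its gradient is bounded and it vanishes at boundary points, so the extension is
Lipschitz on the whole plane, where integration by parts is available. -/

noncomputable section

namespace LambdaSoliton

open Set MeasureTheory Topology

/-! ### Lipschitz bounds for functions vanishing off an open set. -/

section Lipschitz

variable {E : Type*} [NormedAddCommGroup E] [NormedSpace ℝ E]

/-- A continuous function that vanishes off an open set `Ω` and whose derivative is bounded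
on `Ω` grows at most linearly away from the points where it vanishes. -/
theorem abs_le_mul_dist_of_fderiv_le [ProperSpace E] {Ω : Set E} (hΩ : IsOpen Ω) {g : E → ℝ}
    {C : ℝ} (hg : Continuous g) (h0 : ∀ x ∉ Ω, g x = 0) (hd : ∀ x ∈ Ω, DifferentiableAt ℝ g x)
    (hC : ∀ x ∈ Ω, ‖fderiv ℝ g x‖ ≤ C) (hC0 : 0 ≤ C) {x z : E} (hz : z ∉ Ω) :
    |g x| ≤ C * dist x z := by
  by_cases hx : x ∈ Ω
  swap
  · rw [h0 x hx, abs_zero]; positivity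
  obtain ⟨w, hw, hxw⟩ := hΩ.isClosed_compl.exists_infDist_eq_dist ⟨z, hz⟩ x
  have hpos : 0 < dist x w := dist_pos.2 fun h => hw (h ▸ hx)
  have hball : Metric.ball x (dist x w) ⊆ Ω := hxw ▸ Metric.ball_infDist_compl_subset
  have hL : LipschitzOnWith C.toNNReal g (Metric.ball x (dist x w)) := by
    refine LipschitzOnWith.of_dist_le_mul fun a ha c hc => ?_
    rw [Real.coe_toNNReal C hC0, dist_eq_norm, dist_eq_norm]
    exact Convex.norm_image_sub_le_of_norm_fderiv_le (fun y hy => hd y (hball hy))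
      (fun y hy => hC y (hball hy)) (convex_ball _ _) hc ha
  have hL' := LipschitzOnWith.closure hg.continuousOn hL
  rw [closure_ball x hpos.ne'] at hL'
  have := hL'.dist_le_mul x (Metric.mem_closedBall_self hpos.le) w
    (by rw [Metric.mem_closedBall, dist_comm])
  rw [Real.coe_toNNReal C hC0, h0 w hw, Real.dist_eq, sub_zero] at this
  exact this.trans (mul_le_mul_of_nonneg_left (hxw ▸ Metric.infDist_le_dist_of_mem hz) hC0)

/-- If the segment from x to y stays in Ω, the mean value inequality applies. Otherwise it contains
a point z outside Ω, and the linear growth bounds at x and y add up to C times the length of the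
segment. -/
theorem lipschitzWith_of_fderiv_le_of_eq_zero [ProperSpace E] {Ω : Set E} (hΩ : IsOpen Ω)
    {g : E → ℝ} {C : ℝ} (hg : Continuous g) (h0 : ∀ x ∉ Ω, g x = 0)
    (hd : ∀ x ∈ Ω, DifferentiableAt ℝ g x) (hC : ∀ x ∈ Ω, ‖fderiv ℝ g x‖ ≤ C) (hC0 : 0 ≤ C) :
    LipschitzWith C.toNNReal g := by
  refine LipschitzWith.of_dist_le_mul fun x y => ?_
  rw [Real.coe_toNNReal C hC0]
  by_cases hs : segment ℝ x y ⊆ Ω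
  · rw [dist_eq_norm, dist_eq_norm]
    exact Convex.norm_image_sub_le_of_norm_fderiv_le (fun z hz => hd z (hs hz))
      (fun z hz => hC z (hs hz)) (convex_segment x y) (right_mem_segment ℝ x y)
      (left_mem_segment ℝ x y)
  · obtain ⟨z, hz, hzΩ⟩ := not_subset.1 hs
    have h1 := abs_le_mul_dist_of_fderiv_le hΩ hg h0 hd hC hC0 (x := x) hzΩ
    have h2 := abs_le_mul_dist_of_fderiv_le hΩ hg h0 hd hC hC0 (x := y) hzΩ
    rw [← dist_add_dist_of_mem_segment hz, mul_add, dist_comm z y, Real.dist_eq]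
    exact (abs_sub _ _).trans (add_le_add h1 h2)

end Lipschitz

/-! ### The divergence theorem without regularity of the frontier. -/

section Divergence

variable {D K : Set E2} {G : E2 → ℝ}

theorem mem_frontier_of_notMem_interior {D : Set E2} {y : E2} (hy : y ∈ D) (h : y ∉ interior D) :
    y ∈ D ∩ frontier D :=
  ⟨hy, subset_closure hy, h⟩

/-- Off the interior there are two kinds of points. Those in K are boundary points in D, where G
tends to 0 within D; those outside K have a neighbourhood missing the closed set K, on which the
extension is 0. Values of G outside D play no role. -/
theorem continuous_indicator_interior (hK : IsCompact K) (hKD : K ⊆ D) (hG : ContinuousOn G D)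
    (h0 : ∀ y ∈ D \ K, G y = 0) (h1 : ∀ y ∈ D ∩ frontier D, G y = 0) :
    Continuous ((interior D).indicator G) := by
  refine continuous_iff_continuousAt.2 fun y => ?_
  by_cases hy : y ∈ interior D
  · have : G =ᶠ[𝓝 y] (interior D).indicator G := by
      filter_upwards [isOpen_interior.mem_nhds hy] with z hz
      rw [indicator_of_mem hz]
    exact (hG.continuousAt (mem_interior_iff_mem_nhds.1 hy)).congr this
  by_cases hyK : y ∈ K
  · have hyD := hKD hyK
    have hGy := h1 y (mem_frontier_of_notMem_interior hyD hy)
    have hc := hG y hyD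
    rw [ContinuousAt, indicator_of_notMem hy, Metric.tendsto_nhds]
    intro ε hε
    rw [ContinuousWithinAt, hGy, Metric.tendsto_nhds] at hc
    filter_upwards [eventually_nhdsWithin_iff.1 (hc ε hε)] with z hz
    by_cases hzD : z ∈ interior D
    · rw [indicator_of_mem hzD]; exact hz (interior_subset hzD)
    · rw [indicator_of_notMem hzD, dist_self]; exact hε
  · have : (fun _ => (0 : ℝ)) =ᶠ[𝓝 y] (interior D).indicator G := by
      filter_upwards [hK.isClosed.isOpen_compl.mem_nhds hyK] with z hz
      by_cases hzD : z ∈ interior D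
      · rw [indicator_of_mem hzD, h0 z ⟨interior_subset hzD, hz⟩]
      · rw [indicator_of_notMem hzD]
    exact continuousAt_const.congr this

theorem integrableOn_interior_of_continuousOn (hK : IsCompact K) {g : E2 → ℝ}
    (hg : ContinuousOn g K) (h0 : ∀ y ∈ interior D \ K, g y = 0) :
    IntegrableOn g (interior D) := by
  rw [← inter_union_sdiff (interior D) K]
  refine ((hg.integrableOn_compact hK).mono_set inter_subset_right).union ?_
  exact integrableOn_zero.congr_fun (fun y hy => (h0 y hy).symm)
    (isOpen_interior.measurableSet.diff hK.isClosed.measurableSet)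

theorem fderiv_eq_zero_of_notMem_compact (hK : IsCompact K) (h0 : ∀ y ∈ D \ K, G y = 0)
    {y : E2} (hy : y ∈ interior D \ K) : fderiv ℝ G y = 0 := by
  have : G =ᶠ[𝓝 y] fun _ => (0 : ℝ) := by
    filter_upwards [(isOpen_interior.sdiff hK.isClosed).mem_nhds hy] with z hz
    exact h0 z ⟨interior_subset hz.1, hz.2⟩
  rw [this.fderiv_eq, fderiv_fun_const]; rfl

theorem integrableOn_pd (hK : IsCompact K) (hKD : K ⊆ D) (hG : SmoothNear D G)
    (h0 : ∀ y ∈ D \ K, G y = 0) (i : Fin 2) : IntegrableOn (pd i G) (interior D) := by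
  obtain ⟨V, hV, hDV, hGV⟩ := hG
  refine integrableOn_interior_of_continuousOn hK ?_ fun y hy => ?_
  · have := (hGV.continuousOn_fderiv_of_isOpen hV (by simp)).mono (hKD.trans hDV)
    exact this.clm_apply continuousOn_const
  · rw [pd, fderiv_eq_zero_of_notMem_compact hK h0 hy]; rfl

/-- The divergence theorem for functions that vanish on the boundary points of the domain. -/
theorem integral_pd_eq_zero (hnull : volume (D ∩ frontier D) = 0) (hK : IsCompact K)
    (hKD : K ⊆ D) (hG : SmoothNear D G) (h0 : ∀ y ∈ D \ K, G y = 0)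
    (h1 : ∀ y ∈ D ∩ frontier D, G y = 0) (i : Fin 2) :
    ∫ y in interior D, pd i G y = 0 := by
  obtain ⟨V, hV, hDV, hGV⟩ := hG
  set g := (interior D).indicator G with hgdef
  have hgc : Continuous g :=
    continuous_indicator_interior hK hKD (hGV.continuousOn.mono hDV) h0 h1
  have hgout : ∀ x ∉ interior D, g x = 0 := fun x hx => indicator_of_notMem hx _
  have hgG : ∀ x ∈ interior D, g =ᶠ[𝓝 x] G := fun x hx => by
    filter_upwards [isOpen_interior.mem_nhds hx] with z hz
    rw [hgdef, indicator_of_mem hz]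
  have hgd : ∀ x ∈ interior D, DifferentiableAt ℝ g x := fun x hx =>
    ((hGV.contDiffAt (hV.mem_nhds (hDV (interior_subset hx)))).differentiableAt
      (by simp)).congr_of_eventuallyEq (hgG x hx)
  obtain ⟨C, hC⟩ := hK.exists_bound_of_continuousOn
    ((hGV.continuousOn_fderiv_of_isOpen hV (by simp)).mono (hKD.trans hDV))
  -- The maximum with 0 is needed because C may be negative when K is empty.
  have hbound : ∀ x ∈ interior D, ‖fderiv ℝ g x‖ ≤ max C 0 := fun x hx => by
    rw [(hgG x hx).fderiv_eq]
    by_cases hxK : x ∈ K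
    · exact (hC x hxK).trans (le_max_left _ _)
    · rw [fderiv_eq_zero_of_notMem_compact hK h0 ⟨hx, hxK⟩, norm_zero]
      exact le_max_right _ _
  have hLip := lipschitzWith_of_fderiv_le_of_eq_zero isOpen_interior hgc hgout hgd hbound
    (le_max_right _ _)
  have hgK : ∀ x ∉ K, g x = 0 := fun x hx => by
    by_cases hxD : x ∈ interior D
    · rw [hgdef, indicator_of_mem hxD, h0 x ⟨interior_subset hxD, hx⟩]
    · exact hgout x hxD
  -- Integration by parts against the constant 1. The direction is negated because the formula moves
  -- the derivative onto g with the opposite direction.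
  have key := LipschitzWith.integral_lineDeriv_mul_eq (μ := volume)
    (LipschitzWith.const (1 : ℝ) : LipschitzWith 0 fun _ : E2 => (1 : ℝ)) hLip
    (HasCompactSupport.intro hK hgK) (-(EuclideanSpace.single i 1))
  have hconst : ∀ x e : E2, lineDeriv ℝ (fun _ : E2 => (1 : ℝ)) x e = 0 := fun x e => by
    simp [lineDeriv]
  simp only [hconst, zero_mul, integral_zero, neg_neg, mul_one] at key
  rw [← integral_indicator isOpen_interior.measurableSet, key]
  refine integral_congr_ae ?_
  have hae : ∀ᵐ x, x ∉ D ∩ frontier D := measure_eq_zero_iff_ae_notMem.1 hnull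
  filter_upwards [hae] with x hx
  by_cases hxD : x ∈ interior D
  · rw [indicator_of_mem hxD, (hgd x hxD).lineDeriv_eq_fderiv, (hgG x hxD).fderiv_eq, pd]
  · rw [indicator_of_notMem hxD]
    have hxK : x ∉ K := fun h => hx (mem_frontier_of_notMem_interior (hKD h) hxD)
    have hz : g =ᶠ[𝓝 x] fun _ => (0 : ℝ) := by
      filter_upwards [hK.isClosed.isOpen_compl.mem_nhds hxK] with z hz using hgK z hz
    have hd : DifferentiableAt ℝ g x := (differentiableAt_const 0).congr_of_eventuallyEq hz
    rw [hd.lineDeriv_eq_fderiv, hz.fderiv_eq, fderiv_fun_const]; rfl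

theorem IsParameterDomain.ae_eq_interior (hD : IsParameterDomain D) :
    D =ᵐ[volume] interior D := by
  have hae : ∀ᵐ x, x ∉ D ∩ frontier D := measure_eq_zero_iff_ae_notMem.1 hD.boundary_null
  filter_upwards [hae] with x hx
  exact propext ⟨fun h => by_contra fun h' => hx (mem_frontier_of_notMem_interior h h'),
    fun h => interior_subset h⟩

end Divergence

/-! ### Calculus of partial derivatives. -/

section PartialDerivatives

variable {F G : E2 → ℝ} {y : E2} (i : Fin 2)

theorem pd_mul (hF : DifferentiableAt ℝ F y) (hG : DifferentiableAt ℝ G y) :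
    pd i (fun z => F z * G z) y = pd i F y * G y + F y * pd i G y := by
  simp only [pd, fderiv_fun_mul hF hG]
  simp; ring

theorem pd_add (hF : DifferentiableAt ℝ F y) (hG : DifferentiableAt ℝ G y) :
    pd i (fun z => F z + G z) y = pd i F y + pd i G y := by
  simp [pd, fderiv_fun_add hF hG]

theorem pd_sub (hF : DifferentiableAt ℝ F y) (hG : DifferentiableAt ℝ G y) :
    pd i (fun z => F z - G z) y = pd i F y - pd i G y := by
  simp [pd, fderiv_fun_sub hF hG]

theorem pd_neg : pd i (fun z => - F z) y = - pd i F y := by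
  simp [pd]

theorem pd_const (c : ℝ) : pd i (fun _ => c) y = 0 := by
  simp [pd]

theorem pd_sq (hF : DifferentiableAt ℝ F y) :
    pd i (fun z => F z ^ 2) y = 2 * F y * pd i F y := by
  simp only [pow_two, pd_mul i hF hF]; ring

theorem pd_exp (hF : DifferentiableAt ℝ F y) :
    pd i (fun z => Real.exp (F z)) y = Real.exp (F y) * pd i F y := by
  simp [pd, hF.hasFDerivAt.exp.fderiv]

theorem pd_sqrt (hF : DifferentiableAt ℝ F y) (h : 0 < F y) :
    pd i (fun z => √(F z)) y = pd i F y / (2 * √(F y)) := by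
  simp [pd, (hF.hasFDerivAt.sqrt h.ne').fderiv]; ring

theorem pd_inv (hF : DifferentiableAt ℝ F y) (h : F y ≠ 0) :
    pd i (fun z => (F z)⁻¹) y = - pd i F y / F y ^ 2 := by
  have := ((hasDerivAt_inv h).comp_hasFDerivAt y hF.hasFDerivAt).fderiv
  rw [pd, show (fun z => (F z)⁻¹) = Inv.inv ∘ F from rfl, this]
  simp [pd]; ring

theorem pd_congr {E : Type*} [NormedAddCommGroup E] [NormedSpace ℝ E] {F G : E2 → E}
    (h : F =ᶠ[𝓝 y] G) : pd i F y = pd i G y := by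
  rw [pd, pd, h.fderiv_eq]

theorem contDiffOn_pd {V : Set E2} (hV : IsOpen V) (hF : ContDiffOn ℝ ∞ F V) :
    ContDiffOn ℝ ∞ (pd i F) V :=
  (hF.fderiv_of_isOpen hV (by simp)).clm_apply contDiffOn_const

theorem pd_comm (j : Fin 2) (hF : ContDiffAt ℝ 2 F y) : pd i (pd j F) y = pd j (pd i F) y := by
  have hs : IsSymmSndFDerivAt ℝ F y := hF.isSymmSndFDerivAt (by simp)
  have hd : DifferentiableAt ℝ (fderiv ℝ F) y :=
    (hF.fderiv_right (m := 1) one_add_one_eq_two.le).differentiableAt (by simp)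
  have key : ∀ k l : Fin 2, pd k (pd l F) y =
      fderiv ℝ (fderiv ℝ F) y (EuclideanSpace.single k 1) (EuclideanSpace.single l 1) := by
    intro k l
    change fderiv ℝ (fun z => fderiv ℝ F z (EuclideanSpace.single l 1)) y _ = _
    rw [fderiv_clm_apply hd (by fun_prop)]
    simp
  rw [key, key]; exact hs _ _

end PartialDerivatives

/-! ### The geometry of a graph in terms of the derivatives of f. -/

section GraphJets

/-- The squared area density `1 + |∇f|²` of the graph of `f`. -/
def areaSq (f : E2 → ℝ) (y : E2) : ℝ := 1 + pd 0 f y ^ 2 + pd 1 f y ^ 2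

/-- The vector `adj(g) ∇u`, where `g` is the first fundamental form of the graph of `f`. -/
def adjGrad (f u : E2 → ℝ) (i : Fin 2) (y : E2) : ℝ :=
  ![(1 + pd 1 f y ^ 2) * pd 0 u y - pd 0 f y * pd 1 f y * pd 1 u y,
    (1 + pd 0 f y ^ 2) * pd 1 u y - pd 0 f y * pd 1 f y * pd 0 u y] i

/-- Half of the gradient of `areaSq f`. -/
def slopeGrad (f : E2 → ℝ) (i : Fin 2) (y : E2) : ℝ :=
  ![pd 0 f y * pd 0 (pd 0 f) y + pd 1 f y * pd 0 (pd 1 f) y,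
    pd 0 f y * pd 0 (pd 1 f) y + pd 1 f y * pd 1 (pd 1 f) y] i

/-- The vector `adj(g) ∇(areaSq f) / 2`. -/
def slopeFlux (f : E2 → ℝ) (i : Fin 2) (y : E2) : ℝ :=
  ![(1 + pd 1 f y ^ 2) * slopeGrad f 0 y - pd 0 f y * pd 1 f y * slopeGrad f 1 y,
    (1 + pd 0 f y ^ 2) * slopeGrad f 1 y - pd 0 f y * pd 1 f y * slopeGrad f 0 y] i

/-- The numerator of the mean curvature of the graph of `f`. -/
def meanNumerator (f : E2 → ℝ) (y : E2) : ℝ :=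
  (1 + pd 1 f y ^ 2) * pd 0 (pd 0 f) y - 2 * pd 0 f y * pd 1 f y * pd 0 (pd 1 f) y +
    (1 + pd 0 f y ^ 2) * pd 1 (pd 1 f) y

/-- The numerator of the squared norm of the second fundamental form of the graph of `f`. -/
def normSqNumerator (f : E2 → ℝ) (y : E2) : ℝ :=
  ((1 + pd 1 f y ^ 2) * pd 0 (pd 0 f) y - pd 0 f y * pd 1 f y * pd 0 (pd 1 f) y) ^ 2 +
    2 * ((1 + pd 1 f y ^ 2) * pd 0 (pd 1 f) y - pd 0 f y * pd 1 f y * pd 1 (pd 1 f) y) *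
      ((1 + pd 0 f y ^ 2) * pd 0 (pd 1 f) y - pd 0 f y * pd 1 f y * pd 0 (pd 0 f) y) +
    ((1 + pd 0 f y ^ 2) * pd 1 (pd 1 f) y - pd 0 f y * pd 1 f y * pd 0 (pd 1 f) y) ^ 2

theorem areaSq_pos (f : E2 → ℝ) (y : E2) : 0 < areaSq f y := by
  unfold areaSq; positivity

variable (b : OrthonormalBasis (Fin 3) ℝ E3) {f u : E2 → ℝ} {y : E2}

theorem hasFDerivAt_graphMap (hf : DifferentiableAt ℝ f y) :
    HasFDerivAt (graphMap b f)
      (((EuclideanSpace.proj 0 : E2 →L[ℝ] ℝ).smulRight (b 0) +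
        (EuclideanSpace.proj 1 : E2 →L[ℝ] ℝ).smulRight (b 1)) +
        (fderiv ℝ f y).smulRight (b 2)) y := by
  refine HasFDerivAt.add (HasFDerivAt.add ?_ ?_) (hf.hasFDerivAt.smul_const (b 2))
  · exact (EuclideanSpace.proj 0 : E2 →L[ℝ] ℝ).hasFDerivAt.smul_const (b 0)
  · exact (EuclideanSpace.proj 1 : E2 →L[ℝ] ℝ).hasFDerivAt.smul_const (b 1)

theorem pd_graphMap (hf : DifferentiableAt ℝ f y) (i : Fin 2) :
    pd i (graphMap b f) y = b i.castSucc + pd i f y • b 2 := by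
  rw [pd, (hasFDerivAt_graphMap b hf).fderiv]
  fin_cases i <;> simp [pd]

theorem pd_pd_graphMap (hf : ContDiffAt ℝ ∞ f y) (i j : Fin 2) :
    pd i (pd j (graphMap b f)) y = pd i (pd j f) y • b 2 := by
  have h : pd j (graphMap b f) =ᶠ[𝓝 y] fun z => b j.castSucc + pd j f z • b 2 := by
    filter_upwards [(hf.of_le (m := 1) ENat.LEInfty.out).eventually (by simp)] with z hz
    exact pd_graphMap b (hz.differentiableAt (by simp)) j
  have hd : DifferentiableAt ℝ (pd j f) y :=
    ((hf.fderiv_right (m := ∞) (by simp)).clm_apply contDiffAt_const).differentiableAt (by simp)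
  rw [pd_congr i h, pd, fderiv_const_add, fderiv_smul_const hd]
  rfl

theorem firstForm_graphMap (hf : DifferentiableAt ℝ f y) :
    firstForm (graphMap b f) y =
      !![1 + pd 0 f y ^ 2, pd 0 f y * pd 1 f y; pd 0 f y * pd 1 f y, 1 + pd 1 f y ^ 2] := by
  have hb := orthonormal_iff_ite.1 b.orthonormal
  ext i j
  fin_cases i <;> fin_cases j <;>
  · simp [firstForm, pd_graphMap b hf, inner_add_left, inner_add_right, inner_smul_left,
      inner_smul_right, hb]
    try ring

theorem det_firstForm_graphMap (hf : DifferentiableAt ℝ f y) :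
    (firstForm (graphMap b f) y).det = areaSq f y := by
  rw [firstForm_graphMap b hf, Matrix.det_fin_two_of, areaSq]; ring

theorem inv_firstForm_graphMap (hf : DifferentiableAt ℝ f y) :
    (firstForm (graphMap b f) y)⁻¹ = (areaSq f y)⁻¹ •
      !![1 + pd 1 f y ^ 2, -(pd 0 f y * pd 1 f y);
        -(pd 0 f y * pd 1 f y), 1 + pd 0 f y ^ 2] := by
  rw [Matrix.inv_def, det_firstForm_graphMap b hf, Ring.inverse_eq_inv, firstForm_graphMap b hf,
    Matrix.adjugate_fin_two_of]

theorem areaDensity_graphMap (hf : DifferentiableAt ℝ f y) :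
    areaDensity (graphMap b f) y = √(areaSq f y) := by
  rw [areaDensity, det_firstForm_graphMap b hf]

theorem sum_inv_firstForm_mul_pd (hf : DifferentiableAt ℝ f y) (i : Fin 2) :
    ∑ j, (firstForm (graphMap b f) y)⁻¹ i j * pd j u y = (areaSq f y)⁻¹ * adjGrad f u i y := by
  rw [inv_firstForm_graphMap b hf]
  fin_cases i <;> simp [adjGrad] <;> ring

theorem grad_graphMap (hf : DifferentiableAt ℝ f y) :
    grad (graphMap b f) u y = ((areaSq f y)⁻¹ * adjGrad f u 0 y) • (b 0 + pd 0 f y • b 2) +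
      ((areaSq f y)⁻¹ * adjGrad f u 1 y) • (b 1 + pd 1 f y • b 2) := by
  simp only [grad, ← Finset.sum_smul, sum_inv_firstForm_mul_pd b hf, pd_graphMap b hf,
    Fin.sum_univ_two]
  rfl

theorem inner_grad_graphMap (hf : DifferentiableAt ℝ f y) (v : E3) :
    ⟪grad (graphMap b f) u y, v⟫ = (areaSq f y)⁻¹ *
      (adjGrad f u 0 y * (⟪b 0, v⟫ + pd 0 f y * ⟪b 2, v⟫) +
        adjGrad f u 1 y * (⟪b 1, v⟫ + pd 1 f y * ⟪b 2, v⟫)) := by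
  rw [grad_graphMap b hf]
  simp only [inner_add_left, real_inner_smul_left]
  ring

theorem norm_sq_grad_graphMap (hf : DifferentiableAt ℝ f y) :
    ‖grad (graphMap b f) u y‖ ^ 2 = (areaSq f y)⁻¹ *
      (adjGrad f u 0 y * pd 0 u y + adjGrad f u 1 y * pd 1 u y) := by
  have hb := orthonormal_iff_ite.1 b.orthonormal
  have hw := areaSq_pos f y
  have hb2 : ∀ j, ⟪b j, grad (graphMap b f) u y⟫ = ![(areaSq f y)⁻¹ * adjGrad f u 0 y,
      (areaSq f y)⁻¹ * adjGrad f u 1 y,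
      (areaSq f y)⁻¹ * (adjGrad f u 0 y * pd 0 f y + adjGrad f u 1 y * pd 1 f y)] j := by
    intro j
    rw [grad_graphMap b hf]
    fin_cases j <;> simp [inner_add_right, inner_smul_right, hb]
    ring
  -- The formula for ⟪∇u, v⟫ is used with v = ∇u itself.
  rw [← real_inner_self_eq_norm_sq, inner_grad_graphMap b hf, hb2, hb2, hb2]
  simp only [Matrix.cons_val]
  field_simp
  simp only [adjGrad, areaSq, Matrix.cons_val]
  ring

theorem weightedAreaDensity_graphMap (hf : DifferentiableAt ℝ f y) (v : E3) :
    weightedAreaDensity v (graphMap b f) y =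
      Real.exp ⟪graphMap b f y, v⟫ * √(areaSq f y) := by
  rw [weightedAreaDensity, areaDensity_graphMap b hf]

theorem secondForm_graphMap (N : E2 → E3) (hf : ContDiffAt ℝ ∞ f y) :
    secondForm (graphMap b f) N y = ⟪b 2, N y⟫ •
      !![pd 0 (pd 0 f) y, pd 0 (pd 1 f) y; pd 0 (pd 1 f) y, pd 1 (pd 1 f) y] := by
  ext i j
  fin_cases i <;> fin_cases j <;>
    simp [secondForm, pd_pd_graphMap b hf, real_inner_smul_left, mul_comm, pd_comm 1 0 (hf.of_le ENat.LEInfty.out)]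

theorem meanCurvature_graphMap (N : E2 → E3) (hf : ContDiffAt ℝ ∞ f y) :
    meanCurvature (graphMap b f) N y = ⟪b 2, N y⟫ * (areaSq f y)⁻¹ * meanNumerator f y := by
  rw [meanCurvature, shapeOperator, inv_firstForm_graphMap b (hf.differentiableAt (by simp)),
    secondForm_graphMap b N hf, Matrix.trace_fin_two]
  simp [Matrix.mul_apply, Fin.sum_univ_two, meanNumerator]
  ring

theorem normSqA_graphMap (N : E2 → E3) (hf : ContDiffAt ℝ ∞ f y) :
    normSqA (graphMap b f) N y =
      (⟪b 2, N y⟫ * (areaSq f y)⁻¹) ^ 2 * normSqNumerator f y := by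
  rw [normSqA, shapeOperator, inv_firstForm_graphMap b (hf.differentiableAt (by simp)),
    secondForm_graphMap b N hf, Matrix.trace_fin_two]
  simp [Matrix.mul_apply, Fin.sum_univ_two, normSqNumerator]
  ring

/-- Since det g = w, the matrix √(det g) g⁻¹ is w^(-1/2) adj(g). This is needed on a neighbourhood
of y because it gets differentiated. -/
theorem laplaceBeltrami_graphMap (hf : ContDiffAt ℝ ∞ f y) :
    laplaceBeltrami (graphMap b f) u y = (√(areaSq f y))⁻¹ *
      ∑ i, pd i (fun z => (√(areaSq f z))⁻¹ * adjGrad f u i z) y := by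
  rw [laplaceBeltrami, areaDensity_graphMap b (hf.differentiableAt (by simp))]
  congr 1
  refine Finset.sum_congr rfl fun i _ => pd_congr i ?_
  filter_upwards [(hf.of_le (m := 1) ENat.LEInfty.out).eventually (by simp)] with z hz
  have hd := hz.differentiableAt (by simp)
  rw [areaDensity_graphMap b hd, sum_inv_firstForm_mul_pd b hd, ← mul_assoc]
  congr 1
  have hw := areaSq_pos f z
  have := Real.sq_sqrt hw.le
  have := Real.sqrt_pos.2 hw
  field_simp
  assumption

/-- A unit normal of a graph is determined up to its sign. -/
theorem inner_normal_graphMap {n : E3} (hf : DifferentiableAt ℝ f y) (h1 : ‖n‖ = 1)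
    (hn : ∀ i, ⟪n, pd i (graphMap b f) y⟫ = 0) :
    ⟪b 0, n⟫ = -pd 0 f y * ⟪b 2, n⟫ ∧ ⟪b 1, n⟫ = -pd 1 f y * ⟪b 2, n⟫ ∧
      ⟪b 2, n⟫ ^ 2 * areaSq f y = 1 := by
  have h0 := hn 0
  have h2 := hn 1
  rw [pd_graphMap b hf, inner_add_right, inner_smul_right, real_inner_comm _ n,
    real_inner_comm _ n] at h0 h2
  have e0 : ⟪b 0, n⟫ = -pd 0 f y * ⟪b 2, n⟫ := by
    simp at h0; linarith [h0]
  have e1 : ⟪b 1, n⟫ = -pd 1 f y * ⟪b 2, n⟫ := by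
    simp at h2; linarith [h2]
  refine ⟨e0, e1, ?_⟩
  have := b.sum_sq_norm_inner_right n
  rw [Fin.sum_univ_three, h1, e0, e1] at this
  simp only [Real.norm_eq_abs, sq_abs] at this
  rw [areaSq]
  linear_combination this

theorem inner_normal_density {n : E3} (v : E3) (h0 : ⟪b 0, n⟫ = -pd 0 f y * ⟪b 2, n⟫)
    (h1 : ⟪b 1, n⟫ = -pd 1 f y * ⟪b 2, n⟫) :
    ⟪n, v⟫ = ⟪b 2, n⟫ * (⟪b 2, v⟫ - ⟪b 0, v⟫ * pd 0 f y - ⟪b 1, v⟫ * pd 1 f y) := by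
  rw [← b.sum_inner_mul_inner, Fin.sum_univ_three, real_inner_comm, h0,
    real_inner_comm (b 1), h1, real_inner_comm (b 2)]
  ring

end GraphJets

/-! ### The Jacobi equation and the two divergence formulas. -/

section Jacobi

/-- The Jacobi equation for the angle function of a graph, in terms of the partial derivatives of
the graph function up to order three. -/
theorem jacobi_identity_jet {p q r s t a b c d v0 v1 v2 w : ℝ} (hw : w = 1 + p ^ 2 + q ^ 2)
    (hx : ((1 + q ^ 2) * a - 2 * p * q * b + (1 + p ^ 2) * c
        + 2 * q * s * r - 2 * (r * q + p * s) * s + 2 * p * r * t) * w =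
      -(v0 * r + v1 * s) * w ^ 2 + (v2 - v0 * p - v1 * q) * (2 * (p * r + q * s)) * w +
        3 * ((1 + q ^ 2) * r - 2 * p * q * s + (1 + p ^ 2) * t - (v2 - v0 * p - v1 * q) * w) *
          (p * r + q * s))
    (hy : ((1 + q ^ 2) * b - 2 * p * q * c + (1 + p ^ 2) * d
        + 2 * q * t * r - 2 * (s * q + p * t) * s + 2 * p * s * t) * w =
      -(v0 * s + v1 * t) * w ^ 2 + (v2 - v0 * p - v1 * q) * (2 * (p * s + q * t)) * w +
        3 * ((1 + q ^ 2) * r - 2 * p * q * s + (1 + p ^ 2) * t - (v2 - v0 * p - v1 * q) * w) *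
          (p * s + q * t)) :
    (2 * q * s * (p * r + q * s) + (1 + q ^ 2) * (r * r + p * a + s * s + q * b)
      - (r * q + p * s) * (p * s + q * t) - p * q * (r * s + p * b + s * t + q * c)
     + (2 * p * s * (p * s + q * t) + (1 + p ^ 2) * (s * s + p * c + t * t + q * d)
      - (s * q + p * t) * (p * r + q * s) - p * q * (s * r + p * b + t * s + q * c))
     + ((1 + q ^ 2) * (p * r + q * s) - p * q * (p * s + q * t)) * (v0 + p * v2)
     + ((1 + p ^ 2) * (p * s + q * t) - p * q * (p * r + q * s)) * (v1 + q * v2)) * w =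
    ((1 + q ^ 2) * r - p * q * s) ^ 2 +
      2 * ((1 + q ^ 2) * s - p * q * t) * ((1 + p ^ 2) * s - p * q * r) +
      ((1 + p ^ 2) * t - p * q * s) ^ 2 +
    4 * (((1 + q ^ 2) * (p * r + q * s) - p * q * (p * s + q * t)) * (p * r + q * s) +
      ((1 + p ^ 2) * (p * s + q * t) - p * q * (p * r + q * s)) * (p * s + q * t)) := by
  subst hw
  -- The weights (p, q) differentiate the soliton equation along ∇f, which is, up to the factor w,
  -- the tangential part of the translation field `b 2`.
  linear_combination p * hx + q * hy

variable (b : OrthonormalBasis (Fin 3) ℝ E3) {f u : E2 → ℝ} {y : E2}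

theorem contDiffAt_pd (i : Fin 2) (hf : ContDiffAt ℝ ∞ f y) : ContDiffAt ℝ ∞ (pd i f) y :=
  (hf.fderiv_right (m := ∞) (by simp)).clm_apply contDiffAt_const

/-- Symmetry near y, and not only at y, lets third derivatives be reordered by differentiating once
more. -/
theorem pd_one_pd_zero (hf : ContDiffAt ℝ ∞ f y) :
    pd 1 (pd 0 f) =ᶠ[𝓝 y] pd 0 (pd 1 f) := by
  filter_upwards [(hf.of_le (m := 2) ENat.LEInfty.out).eventually (by simp)] with z hz
  exact pd_comm 1 0 hz

theorem pd_areaSq (hf : ContDiffAt ℝ ∞ f y) (i : Fin 2) :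
    pd i (areaSq f) y = 2 * slopeGrad f i y := by
  have d0 := (contDiffAt_pd 0 hf).differentiableAt (by simp)
  have d1 := (contDiffAt_pd 1 hf).differentiableAt (by simp)
  unfold areaSq
  rw [pd_add i (by fun_prop) (by fun_prop), pd_add i (by fun_prop) (by fun_prop), pd_sq i d0,
    pd_sq i d1, pd_const]
  fin_cases i <;> simp [slopeGrad, pd_comm 1 0 (hf.of_le ENat.LEInfty.out)] <;> ring

theorem differentiableAt_areaSq (hf : ContDiffAt ℝ ∞ f y) : DifferentiableAt ℝ (areaSq f) y := by
  have d0 := (contDiffAt_pd 0 hf).differentiableAt (by simp)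
  have d1 := (contDiffAt_pd 1 hf).differentiableAt (by simp)
  unfold areaSq
  fun_prop

theorem pd_meanNumerator (hf : ContDiffAt ℝ ∞ f y) (i : Fin 2) :
    pd i (meanNumerator f) y =
      (1 + pd 1 f y ^ 2) * pd i (pd 0 (pd 0 f)) y
        - 2 * pd 0 f y * pd 1 f y * pd i (pd 0 (pd 1 f)) y
        + (1 + pd 0 f y ^ 2) * pd i (pd 1 (pd 1 f)) y
        + 2 * pd 1 f y * pd i (pd 1 f) y * pd 0 (pd 0 f) y
        - 2 * (pd i (pd 0 f) y * pd 1 f y + pd 0 f y * pd i (pd 1 f) y) * pd 0 (pd 1 f) y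
        + 2 * pd 0 f y * pd i (pd 0 f) y * pd 1 (pd 1 f) y := by
  have c0 := contDiffAt_pd 0 hf
  have c1 := contDiffAt_pd 1 hf
  have d0 := c0.differentiableAt (by simp)
  have d1 := c1.differentiableAt (by simp)
  have d00 := (contDiffAt_pd 0 c0).differentiableAt (by simp)
  have d01 := (contDiffAt_pd 0 c1).differentiableAt (by simp)
  have d11 := (contDiffAt_pd 1 c1).differentiableAt (by simp)
  unfold meanNumerator
  simp (disch := fun_prop) only [pd_add, pd_sub, pd_mul, pd_sq, pd_const]
  ring

theorem pd_slopeFlux_zero (hf : ContDiffAt ℝ ∞ f y) :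
    pd 0 (slopeFlux f 0) y =
      2 * pd 1 f y * pd 0 (pd 1 f) y * slopeGrad f 0 y + (1 + pd 1 f y ^ 2) *
        (pd 0 (pd 0 f) y * pd 0 (pd 0 f) y + pd 0 f y * pd 0 (pd 0 (pd 0 f)) y +
          pd 0 (pd 1 f) y * pd 0 (pd 1 f) y + pd 1 f y * pd 0 (pd 0 (pd 1 f)) y)
      - (pd 0 (pd 0 f) y * pd 1 f y + pd 0 f y * pd 0 (pd 1 f) y) * slopeGrad f 1 y
      - pd 0 f y * pd 1 f y *
        (pd 0 (pd 0 f) y * pd 0 (pd 1 f) y + pd 0 f y * pd 0 (pd 0 (pd 1 f)) y +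
          pd 0 (pd 1 f) y * pd 1 (pd 1 f) y + pd 1 f y * pd 0 (pd 1 (pd 1 f)) y) := by
  have c0 := contDiffAt_pd 0 hf
  have c1 := contDiffAt_pd 1 hf
  have d0 := c0.differentiableAt (by simp)
  have d1 := c1.differentiableAt (by simp)
  have d00 := (contDiffAt_pd 0 c0).differentiableAt (by simp)
  have d01 := (contDiffAt_pd 0 c1).differentiableAt (by simp)
  have d11 := (contDiffAt_pd 1 c1).differentiableAt (by simp)
  unfold slopeFlux slopeGrad
  simp only [Matrix.cons_val]
  simp (disch := fun_prop) only [pd_add, pd_sub, pd_mul, pd_sq, pd_const]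
  ring

theorem pd_slopeFlux_one (hf : ContDiffAt ℝ ∞ f y) :
    pd 1 (slopeFlux f 1) y =
      2 * pd 0 f y * pd 0 (pd 1 f) y * slopeGrad f 1 y + (1 + pd 0 f y ^ 2) *
        (pd 0 (pd 1 f) y * pd 0 (pd 1 f) y + pd 0 f y * pd 0 (pd 1 (pd 1 f)) y +
          pd 1 (pd 1 f) y * pd 1 (pd 1 f) y + pd 1 f y * pd 1 (pd 1 (pd 1 f)) y)
      - (pd 0 (pd 1 f) y * pd 1 f y + pd 0 f y * pd 1 (pd 1 f) y) * slopeGrad f 0 y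
      - pd 0 f y * pd 1 f y *
        (pd 0 (pd 1 f) y * pd 0 (pd 0 f) y + pd 0 f y * pd 0 (pd 0 (pd 1 f)) y +
          pd 1 (pd 1 f) y * pd 0 (pd 1 f) y + pd 1 f y * pd 0 (pd 1 (pd 1 f)) y) := by
  have c0 := contDiffAt_pd 0 hf
  have c1 := contDiffAt_pd 1 hf
  have d0 := c0.differentiableAt (by simp)
  have d1 := c1.differentiableAt (by simp)
  have d00 := (contDiffAt_pd 0 c0).differentiableAt (by simp)
  have d01 := (contDiffAt_pd 0 c1).differentiableAt (by simp)
  have d11 := (contDiffAt_pd 1 c1).differentiableAt (by simp)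
  have e10 := pd_comm 1 0 (hf.of_le ENat.LEInfty.out)
  have e100 : pd 1 (pd 0 (pd 0 f)) y = pd 0 (pd 0 (pd 1 f)) y :=
    (pd_comm 1 0 (c0.of_le ENat.LEInfty.out)).trans (pd_congr 0 (pd_one_pd_zero hf))
  have e101 := pd_comm 1 0 (c1.of_le ENat.LEInfty.out)
  unfold slopeFlux slopeGrad
  simp only [Matrix.cons_val]
  simp (disch := fun_prop) only [pd_add, pd_sub, pd_mul, pd_sq, pd_const]
  rw [e10, e100, e101]
  ring

/-- The Jacobi equation for the angle function `areaSq f ^ (-1 / 2)` of a graph of constant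
weighted mean curvature. -/
theorem jacobi_equation {v0 v1 v2 c : ℝ} (hf : ContDiffAt ℝ ∞ f y)
    (h : ∀ᶠ z in 𝓝 y, meanNumerator f z =
      (v2 - v0 * pd 0 f z - v1 * pd 1 f z) * areaSq f z + c * (areaSq f z * √(areaSq f z))) :
    (pd 0 (slopeFlux f 0) y + pd 1 (slopeFlux f 1) y + slopeFlux f 0 y * (v0 + pd 0 f y * v2) +
      slopeFlux f 1 y * (v1 + pd 1 f y * v2)) * areaSq f y =
    normSqNumerator f y +
      4 * (slopeFlux f 0 y * slopeGrad f 0 y + slopeFlux f 1 y * slopeGrad f 1 y) := by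
  have c0 := contDiffAt_pd 0 hf
  have c1 := contDiffAt_pd 1 hf
  have d0 := c0.differentiableAt (by simp)
  have d1 := c1.differentiableAt (by simp)
  have hwpos := areaSq_pos f y
  have dw := differentiableAt_areaSq hf
  have ds : DifferentiableAt ℝ (fun z => √(areaSq f z)) y := dw.sqrt hwpos.ne'
  have e10 := pd_comm 1 0 (hf.of_le ENat.LEInfty.out)
  have e100 : pd 1 (pd 0 (pd 0 f)) y = pd 0 (pd 0 (pd 1 f)) y :=
    (pd_comm 1 0 (c0.of_le ENat.LEInfty.out)).trans (pd_congr 0 (pd_one_pd_zero hf))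
  have e101 := pd_comm 1 0 (c1.of_le ENat.LEInfty.out)
  have hM := h.self_of_nhds
  -- The derivative of the soliton equation times w. Since ∂w = 2 `slopeGrad`, the term c w^(3/2)
  -- has derivative 3c √w `slopeGrad`; after multiplication by w the equation itself eliminates c
  -- and the root.
  have hd : ∀ i, pd i (meanNumerator f) y * areaSq f y =
      -(v0 * pd i (pd 0 f) y + v1 * pd i (pd 1 f) y) * areaSq f y ^ 2 +
        (v2 - v0 * pd 0 f y - v1 * pd 1 f y) * (2 * slopeGrad f i y) * areaSq f y +
        3 * (meanNumerator f y - (v2 - v0 * pd 0 f y - v1 * pd 1 f y) * areaSq f y) *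
          slopeGrad f i y := by
    intro i
    rw [pd_congr i h]
    have hs := Real.sqrt_pos.2 hwpos
    have hsq := Real.sq_sqrt hwpos.le
    simp (disch := first | assumption | fun_prop) only [pd_add, pd_sub, pd_mul, pd_const,
      pd_sqrt, pd_areaSq hf]
    rw [hM]
    field_simp
    rw [hsq]
    linear_combination (-3 * slopeGrad f i y * c) * hsq
  have hx := hd 0
  have hy := hd 1
  rw [pd_meanNumerator hf] at hx hy
  rw [e10, e100, e101] at hy
  rw [pd_slopeFlux_zero hf, pd_slopeFlux_one hf]
  simp only [slopeFlux, slopeGrad, normSqNumerator, meanNumerator, Matrix.cons_val] at hx hy ⊢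
  linear_combination jacobi_identity_jet (w := areaSq f y) rfl hx hy

theorem pd_inner_graphMap (hf : DifferentiableAt ℝ f y) (v : E3) (i : Fin 2) :
    pd i (fun z => ⟪graphMap b f z, v⟫) y = ⟪b i.castSucc, v⟫ + pd i f y * ⟪b 2, v⟫ := by
  have hX := hasFDerivAt_graphMap b hf
  rw [pd, (hX.inner ℝ (hasFDerivAt_const v y)).fderiv]
  have := pd_graphMap b hf i
  rw [pd, hX.fderiv] at this
  simp only [fderivInnerCLM_apply, ContinuousLinearMap.comp_apply,
    ContinuousLinearMap.prod_apply, this]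
  simp [inner_add_left, real_inner_smul_left]

/-- The integrand of the second variation in the coordinates of a graph. -/
def graphEnergy (v : E3) (f u : E2 → ℝ) (y : E2) : ℝ :=
  Real.exp ⟪graphMap b f y, v⟫ * (√(areaSq f y))⁻¹ *
    (adjGrad f u 0 y * pd 0 u y + adjGrad f u 1 y * pd 1 u y -
      normSqNumerator f y * u y ^ 2 * ((areaSq f y)⁻¹) ^ 2)

/-- The vector field `-u² e^φ ∇(areaSq f) / (2 areaSq f)`, weighted by the area density. -/
def angleFlux (v : E3) (f u : E2 → ℝ) (i : Fin 2) (y : E2) : ℝ :=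
  -(u y ^ 2 * (Real.exp ⟪graphMap b f y, v⟫ * ((√(areaSq f y))⁻¹ * (areaSq f y)⁻¹) *
    slopeFlux f i y))

/-- The vector field `u e^φ ∇u`, weighted by the area density. -/
def energyFlux (v : E3) (f u : E2 → ℝ) (i : Fin 2) (y : E2) : ℝ :=
  u y * (Real.exp ⟪graphMap b f y, v⟫ * ((√(areaSq f y))⁻¹ * adjGrad f u i y))

/-- The normal enters |A|² only through ⟪`b 2`, N⟫² = 1/w, so neither the sign of N nor its mere
continuity matters afterwards. -/
theorem energy_eq_graphEnergy {v : E3} {N : E2 → E3} (hf : ContDiffAt ℝ ∞ f y)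
    (hN : ⟪b 2, N y⟫ ^ 2 * areaSq f y = 1) :
    (‖grad (graphMap b f) u y‖ ^ 2 - normSqA (graphMap b f) N y * u y ^ 2) *
      weightedAreaDensity v (graphMap b f) y = graphEnergy b v f u y := by
  have hd := hf.differentiableAt (by simp)
  have hw := areaSq_pos f y
  have hs := Real.sqrt_pos.2 hw
  have hsq := Real.sq_sqrt hw.le
  rw [norm_sq_grad_graphMap b hd, normSqA_graphMap b N hf, weightedAreaDensity_graphMap b hd,
    graphEnergy]
  have hn : ⟪b 2, N y⟫ ^ 2 = (areaSq f y)⁻¹ := eq_inv_of_mul_eq_one_left hN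
  rw [mul_pow, hn]
  field_simp
  rw [hsq]
  ring

/-- This is the product rule for div(u e^φ ∇u). The |A|² terms cancel, so neither the soliton
equation nor any property of N is involved. -/
theorem energy_density_eq_divergence_sub {v : E3} {N : E2 → E3} (hf : ContDiffAt ℝ ∞ f y)
    (hu : ContDiffAt ℝ ∞ u y) :
    u y * stabilityOperator v (graphMap b f) N u y * weightedAreaDensity v (graphMap b f) y =
      ∑ i, pd i (energyFlux b v f u i) y -
      (‖grad (graphMap b f) u y‖ ^ 2 - normSqA (graphMap b f) N y * u y ^ 2) *
        weightedAreaDensity v (graphMap b f) y := by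
  have hd := hf.differentiableAt (by simp)
  have hw := areaSq_pos f y
  have hs := Real.sqrt_pos.2 hw
  have hsq := Real.sq_sqrt hw.le
  have c0 := contDiffAt_pd 0 hf
  have c1 := contDiffAt_pd 1 hf
  have d0 := c0.differentiableAt (by simp)
  have d1 := c1.differentiableAt (by simp)
  have dw := differentiableAt_areaSq hf
  have ds : DifferentiableAt ℝ (fun z => (√(areaSq f z))⁻¹) y := (dw.sqrt hw.ne').inv hs.ne'
  have du := hu.differentiableAt (by simp)
  have du0 := (contDiffAt_pd 0 hu).differentiableAt (by simp)
  have du1 := (contDiffAt_pd 1 hu).differentiableAt (by simp)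
  have da : ∀ i, DifferentiableAt ℝ (fun z => adjGrad f u i z) y := by
    unfold adjGrad
    refine Fin.forall_fin_two.2 ⟨?_, ?_⟩ <;> simp only [Matrix.cons_val] <;> fun_prop
  have dF : ∀ i, DifferentiableAt ℝ (fun z => (√(areaSq f z))⁻¹ * adjGrad f u i z) y :=
    fun i => ds.mul (da i)
  have dφ : DifferentiableAt ℝ (fun z => ⟪graphMap b f z, v⟫) y :=
    (hasFDerivAt_graphMap b hd).differentiableAt.inner ℝ (differentiableAt_const v)
  have key : ∀ i, pd i (energyFlux b v f u i) y = Real.exp ⟪graphMap b f y, v⟫ *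
      ((pd i u y + u y * (⟪b i.castSucc, v⟫ + pd i f y * ⟪b 2, v⟫)) *
          ((√(areaSq f y))⁻¹ * adjGrad f u i y) +
        u y * pd i (fun z => (√(areaSq f z))⁻¹ * adjGrad f u i z) y) := by
    intro i
    unfold energyFlux
    have dEF : DifferentiableAt ℝ (fun z => Real.exp ⟪graphMap b f z, v⟫ *
      ((√(areaSq f z))⁻¹ * adjGrad f u i z)) y := dφ.exp.mul (dF i)
    rw [pd_mul i du dEF, pd_mul i dφ.exp (dF i), pd_exp i dφ,
      pd_inner_graphMap b hd]
    ring
  rw [stabilityOperator, laplaceBeltrami_graphMap b hf, inner_grad_graphMap b hd,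
    norm_sq_grad_graphMap b hd, weightedAreaDensity_graphMap b hd]
  simp only [Fin.sum_univ_two, key]
  simp only [Fin.castSucc_zero, Fin.castSucc_one]
  have hw' : areaSq f y = √(areaSq f y) ^ 2 := hsq.symm
  rw [hw', Real.sqrt_sq hs.le]
  field_simp
  ring

theorem divergence_angleFlux_le {v : E3} {c : ℝ} (hf : ContDiffAt ℝ ∞ f y)
    (hu : ContDiffAt ℝ ∞ u y)
    (h : ∀ᶠ z in 𝓝 y, meanNumerator f z =
      (⟪b 2, v⟫ - ⟪b 0, v⟫ * pd 0 f z - ⟪b 1, v⟫ * pd 1 f z) * areaSq f z +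
        c * (areaSq f z * √(areaSq f z))) :
    ∑ i, pd i (angleFlux b v f u i) y ≤ graphEnergy b v f u y := by
  have hJ := jacobi_equation hf h
  have hd := hf.differentiableAt (by simp)
  have hw := areaSq_pos f y
  have hs := Real.sqrt_pos.2 hw
  have hsq := Real.sq_sqrt hw.le
  have c0 := contDiffAt_pd 0 hf
  have c1 := contDiffAt_pd 1 hf
  have d0 := c0.differentiableAt (by simp)
  have d1 := c1.differentiableAt (by simp)
  have d00 := (contDiffAt_pd 0 c0).differentiableAt (by simp)
  have d01 := (contDiffAt_pd 0 c1).differentiableAt (by simp)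
  have d11 := (contDiffAt_pd 1 c1).differentiableAt (by simp)
  have dw := differentiableAt_areaSq hf
  have dr : DifferentiableAt ℝ (fun z => √(areaSq f z)) y := dw.sqrt hw.ne'
  have ds : DifferentiableAt ℝ (fun z => (√(areaSq f z))⁻¹) y := dr.inv hs.ne'
  have dwi : DifferentiableAt ℝ (fun z => (areaSq f z)⁻¹) y := dw.inv hw.ne'
  have du := hu.differentiableAt (by simp)
  have dB : ∀ i, DifferentiableAt ℝ (fun z => slopeFlux f i z) y := by
    unfold slopeFlux slopeGrad
    refine Fin.forall_fin_two.2 ⟨?_, ?_⟩ <;> simp only [Matrix.cons_val] <;> fun_prop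
  have dφ : DifferentiableAt ℝ (fun z => ⟪graphMap b f z, v⟫) y :=
    (hasFDerivAt_graphMap b hd).differentiableAt.inner ℝ (differentiableAt_const v)
  have key : ∀ i, pd i (angleFlux b v f u i) y =
      -(Real.exp ⟪graphMap b f y, v⟫ * (√(areaSq f y))⁻¹ * (areaSq f y)⁻¹ *
        (2 * u y * pd i u y * slopeFlux f i y + u y ^ 2 * (pd i (slopeFlux f i) y +
          slopeFlux f i y * (⟪b i.castSucc, v⟫ + pd i f y * ⟪b 2, v⟫)
          - 3 * slopeFlux f i y * slopeGrad f i y * (areaSq f y)⁻¹))) := by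
    intro i
    unfold angleFlux
    have dE := dφ.exp
    have dsw : DifferentiableAt ℝ (fun z => (√(areaSq f z))⁻¹ * (areaSq f z)⁻¹) y := ds.mul dwi
    have dEsw : DifferentiableAt ℝ (fun z => Real.exp ⟪graphMap b f z, v⟫ *
      ((√(areaSq f z))⁻¹ * (areaSq f z)⁻¹)) y := dE.mul dsw
    have dEswB : DifferentiableAt ℝ (fun z => Real.exp ⟪graphMap b f z, v⟫ *
      ((√(areaSq f z))⁻¹ * (areaSq f z)⁻¹) * slopeFlux f i z) y := dEsw.mul (dB i)
    have du2 : DifferentiableAt ℝ (fun z => u z ^ 2) y := du.pow 2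
    rw [pd_neg, pd_mul i du2 dEswB, pd_sq i du, pd_mul i dEsw (dB i), pd_mul i dE dsw, pd_mul i ds dwi,
      pd_exp i dφ, pd_inv i dr hs.ne', pd_inv i dw hw.ne', pd_sqrt i dw hw, pd_areaSq hf,
      pd_inner_graphMap b hd, hsq]
    field_simp
    ring
  set S := √(areaSq f y)
  set E := Real.exp ⟪graphMap b f y, v⟫
  have hE : 0 < E := Real.exp_pos _
  -- The difference is the density of |∇u + u∇w/(2w)|². The form adj(g) is written as a sum of
  -- squares: (1+q²)α² - 2pqαβ + (1+p²)β² = α² + β² + (qα - pβ)².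
  have hdiff : graphEnergy b v f u y - ∑ i, pd i (angleFlux b v f u i) y = E * S⁻¹ *
      ((pd 0 u y + u y * slopeGrad f 0 y * (areaSq f y)⁻¹) ^ 2 +
        (pd 1 u y + u y * slopeGrad f 1 y * (areaSq f y)⁻¹) ^ 2 +
        (pd 1 f y * (pd 0 u y + u y * slopeGrad f 0 y * (areaSq f y)⁻¹) -
          pd 0 f y * (pd 1 u y + u y * slopeGrad f 1 y * (areaSq f y)⁻¹)) ^ 2) := by
    have hT : normSqNumerator f y = (pd 0 (slopeFlux f 0) y + pd 1 (slopeFlux f 1) y +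
        slopeFlux f 0 y * (⟪b 0, v⟫ + pd 0 f y * ⟪b 2, v⟫) +
        slopeFlux f 1 y * (⟪b 1, v⟫ + pd 1 f y * ⟪b 2, v⟫)) * areaSq f y -
        4 * (slopeFlux f 0 y * slopeGrad f 0 y + slopeFlux f 1 y * slopeGrad f 1 y) := by
      linear_combination -hJ
    rw [Fin.sum_univ_two, key, key, graphEnergy, hT]
    simp only [Fin.castSucc_zero, Fin.castSucc_one]
    generalize pd 0 (slopeFlux f 0) y = B0
    generalize pd 1 (slopeFlux f 1) y = B1
    simp only [slopeFlux, adjGrad, Matrix.cons_val]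
    field_simp
    ring
  have : 0 ≤ graphEnergy b v f u y - ∑ i, pd i (angleFlux b v f u i) y := by
    rw [hdiff]; positivity
  linarith

end Jacobi

/-! ### The soliton equation as an equation for f. -/

section Soliton

variable {b : OrthonormalBasis (Fin 3) ℝ E3} {f : E2 → ℝ} {v : E3} {lam : ℝ} {D : Set E2}
  {N : E2 → E3} {y : E2}

/-- The equation of translating solitons for graphs. -/
theorem IsTranslatingSoliton.eventually_meanNumerator_eq
    (hS : IsTranslatingSoliton v lam D (graphMap b f) N)
    (hf : ∀ z ∈ D, ContDiffAt ℝ ∞ f z) (hy : y ∈ interior D) :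
    ∃ c : ℝ, ∀ᶠ z in 𝓝 y, meanNumerator f z =
      (⟪b 2, v⟫ - ⟪b 0, v⟫ * pd 0 f z - ⟪b 1, v⟫ * pd 1 f z) * areaSq f z +
        c * (areaSq f z * √(areaSq f z)) := by
  have hnormal : ∀ z ∈ D, _ := fun z hz => inner_normal_graphMap b
    ((hf z hz).differentiableAt (by simp)) (hS.gauss.norm_eq_one z hz) (hS.gauss.normal z hz)
  set ε : E2 → ℝ := fun z => ⟪b 2, N z⟫ * √(areaSq f z) with hε
  have hε2 : ∀ z ∈ D, ε z ^ 2 = 1 := fun z hz => by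
    rw [hε]; simp only [mul_pow, Real.sq_sqrt (areaSq_pos f z).le, (hnormal z hz).2.2]
  have hyD := interior_subset hy
  have hεc : ContinuousAt ε y := by
    have h1 : ContinuousAt N y :=
      hS.gauss.continuousOn.continuousAt (mem_interior_iff_mem_nhds.1 hy)
    exact (continuousAt_const.inner h1).mul
      (differentiableAt_areaSq (hf y hyD)).continuousAt.sqrt
  -- ε is the orientation sign of N relative to `b 2`. It is continuous at y with values ±1, which
  -- are at distance 2, so it is constant where it varies by less than 1. The constant c is only
  -- local, as D may be disconnected.
  refine ⟨lam * ε y, ?_⟩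
  filter_upwards [isOpen_interior.mem_nhds hy, Metric.tendsto_nhds.1 hεc 1 one_pos] with z hz hzε
  have hzD := interior_subset hz
  have hεeq : ε z = ε y := by
    rw [Real.dist_eq, abs_lt] at hzε
    rcases eq_or_eq_neg_of_sq_eq_sq _ _ ((hε2 z hzD).trans (hε2 y hyD).symm) with h | h
    · exact h
    · have := hε2 y hyD
      rw [h] at hzε
      nlinarith
  obtain ⟨h0, h1, h2⟩ := hnormal z hzD
  have hw := areaSq_pos f z
  have hsq := Real.sq_sqrt hw.le
  have hH := hS.soliton z hzD
  rw [meanCurvature_graphMap b N (hf z hzD), inner_normal_density b v h0 h1] at hH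
  rw [← hεeq, hε]
  field_simp at hH
  linear_combination (areaSq f z * ⟪b 2, N z⟫) * hH +
    ((⟪b 2, v⟫ - ⟪b 0, v⟫ * pd 0 f z - ⟪b 1, v⟫ * pd 1 f z) * areaSq f z -
      meanNumerator f z) * h2 - lam * ⟪b 2, N z⟫ * areaSq f z * hsq

end Soliton

/-! ### Smoothness of the energy density and the fluxes. -/

section Smoothness

variable (b : OrthonormalBasis (Fin 3) ℝ E3) {f u : E2 → ℝ} {V : Set E2}

theorem contDiffOn_of_graphMap (h : ContDiffOn ℝ ∞ (graphMap b f) V) : ContDiffOn ℝ ∞ f V := by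
  have hb := orthonormal_iff_ite.1 b.orthonormal
  have : f = fun y => ⟪b 2, graphMap b f y⟫ := by
    funext y
    simp [graphMap, inner_add_right, inner_smul_right, hb]
  rw [this]
  exact contDiffOn_const.inner ℝ h

theorem contDiffOn_areaSq (hV : IsOpen V) (hf : ContDiffOn ℝ ∞ f V) :
    ContDiffOn ℝ ∞ (areaSq f) V := by
  have c0 := contDiffOn_pd 0 hV hf
  have c1 := contDiffOn_pd 1 hV hf
  unfold areaSq
  fun_prop

theorem contDiffOn_inv_sqrt_areaSq (hV : IsOpen V) (hf : ContDiffOn ℝ ∞ f V) :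
    ContDiffOn ℝ ∞ (fun y => (√(areaSq f y))⁻¹) V :=
  ((contDiffOn_areaSq hV hf).sqrt fun y _ => (areaSq_pos f y).ne').inv fun y _ =>
    (Real.sqrt_pos.2 (areaSq_pos f y)).ne'

theorem contDiffOn_inv_areaSq (hV : IsOpen V) (hf : ContDiffOn ℝ ∞ f V) :
    ContDiffOn ℝ ∞ (fun y => (areaSq f y)⁻¹) V :=
  (contDiffOn_areaSq hV hf).inv fun y _ => (areaSq_pos f y).ne'

theorem contDiffOn_adjGrad (hV : IsOpen V) (hf : ContDiffOn ℝ ∞ f V) (hu : ContDiffOn ℝ ∞ u V)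
    (i : Fin 2) : ContDiffOn ℝ ∞ (adjGrad f u i) V := by
  have c0 := contDiffOn_pd 0 hV hf
  have c1 := contDiffOn_pd 1 hV hf
  have u0 := contDiffOn_pd 0 hV hu
  have u1 := contDiffOn_pd 1 hV hu
  revert i
  unfold adjGrad
  refine Fin.forall_fin_two.2 ⟨?_, ?_⟩ <;> simp only [Matrix.cons_val] <;> fun_prop

theorem contDiffOn_slopeFlux (hV : IsOpen V) (hf : ContDiffOn ℝ ∞ f V) (i : Fin 2) :
    ContDiffOn ℝ ∞ (slopeFlux f i) V := by
  have c0 := contDiffOn_pd 0 hV hf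
  have c1 := contDiffOn_pd 1 hV hf
  have c00 := contDiffOn_pd 0 hV c0
  have c01 := contDiffOn_pd 0 hV c1
  have c11 := contDiffOn_pd 1 hV c1
  revert i
  unfold slopeFlux slopeGrad
  refine Fin.forall_fin_two.2 ⟨?_, ?_⟩ <;> simp only [Matrix.cons_val] <;> fun_prop

theorem contDiffOn_normSqNumerator (hV : IsOpen V) (hf : ContDiffOn ℝ ∞ f V) :
    ContDiffOn ℝ ∞ (normSqNumerator f) V := by
  have c0 := contDiffOn_pd 0 hV hf
  have c1 := contDiffOn_pd 1 hV hf
  have c00 := contDiffOn_pd 0 hV c0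
  have c01 := contDiffOn_pd 0 hV c1
  have c11 := contDiffOn_pd 1 hV c1
  unfold normSqNumerator
  fun_prop

variable (v : E3)

theorem contDiffOn_exp_inner_graphMap (hX : ContDiffOn ℝ ∞ (graphMap b f) V) :
    ContDiffOn ℝ ∞ (fun y => Real.exp ⟪graphMap b f y, v⟫) V :=
  (hX.inner ℝ contDiffOn_const).exp

theorem contDiffOn_graphEnergy (hV : IsOpen V) (hX : ContDiffOn ℝ ∞ (graphMap b f) V)
    (hu : ContDiffOn ℝ ∞ u V) : ContDiffOn ℝ ∞ (graphEnergy b v f u) V := by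
  have hf := contDiffOn_of_graphMap b hX
  have h1 := contDiffOn_exp_inner_graphMap b v hX
  have h2 := contDiffOn_inv_sqrt_areaSq hV hf
  have h3 := contDiffOn_inv_areaSq hV hf
  have h4 := contDiffOn_adjGrad hV hf hu
  have h5 := contDiffOn_normSqNumerator hV hf
  have u0 := contDiffOn_pd 0 hV hu
  have u1 := contDiffOn_pd 1 hV hu
  exact (h1.mul h2).mul ((((h4 0).mul u0).add ((h4 1).mul u1)).sub
    ((h5.mul (hu.pow 2)).mul (h3.pow 2)))

theorem contDiffOn_angleFlux (hV : IsOpen V) (hX : ContDiffOn ℝ ∞ (graphMap b f) V)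
    (hu : ContDiffOn ℝ ∞ u V) (i : Fin 2) : ContDiffOn ℝ ∞ (angleFlux b v f u i) V := by
  have hf := contDiffOn_of_graphMap b hX
  exact ((hu.pow 2).mul (((contDiffOn_exp_inner_graphMap b v hX).mul
    ((contDiffOn_inv_sqrt_areaSq hV hf).mul (contDiffOn_inv_areaSq hV hf))).mul
      (contDiffOn_slopeFlux hV hf i))).neg

theorem contDiffOn_energyFlux (hV : IsOpen V) (hX : ContDiffOn ℝ ∞ (graphMap b f) V)
    (hu : ContDiffOn ℝ ∞ u V) (i : Fin 2) : ContDiffOn ℝ ∞ (energyFlux b v f u i) V := by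
  have hf := contDiffOn_of_graphMap b hX
  exact hu.mul ((contDiffOn_exp_inner_graphMap b v hX).mul
    ((contDiffOn_inv_sqrt_areaSq hV hf).mul (contDiffOn_adjGrad hV hf hu i)))

end Smoothness

/-! ### Integration: the energy identity and stability. -/

section Stability

variable {b : OrthonormalBasis (Fin 3) ℝ E3} {f u : E2 → ℝ} {v : E3} {lam : ℝ} {D : Set E2}
  {N : E2 → E3}

/-- The energy identity and the stability inequality for graphical translating solitons. -/
theorem IsTranslatingSoliton.energy_identity_and_nonneg
    (hS : IsTranslatingSoliton v lam D (graphMap b f) N) (hu : IsTestFunction D u) :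
    IntegrableOn (fun y => u y * stabilityOperator v (graphMap b f) N u y *
      weightedAreaDensity v (graphMap b f) y) D ∧
    IntegrableOn (fun y => (‖grad (graphMap b f) u y‖ ^ 2 -
      normSqA (graphMap b f) N y * u y ^ 2) * weightedAreaDensity v (graphMap b f) y) D ∧
    Qphi v D (graphMap b f) N u = ∫ y in D, (‖grad (graphMap b f) u y‖ ^ 2 -
      normSqA (graphMap b f) N y * u y ^ 2) * weightedAreaDensity v (graphMap b f) y ∧
    0 ≤ ∫ y in D, (‖grad (graphMap b f) u y‖ ^ 2 -
      normSqA (graphMap b f) N y * u y ^ 2) * weightedAreaDensity v (graphMap b f) y := by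
  obtain ⟨V, hV, hDV, hX, huV⟩ : ∃ V : Set E2, IsOpen V ∧ D ⊆ V ∧
      ContDiffOn ℝ ∞ (graphMap b f) V ∧ ContDiffOn ℝ ∞ u V := by
    obtain ⟨V, hV, hDV, hX⟩ := hS.smooth
    obtain ⟨V', hV', hDV', hu'⟩ := hu.smooth
    exact ⟨V ∩ V', hV.inter hV', subset_inter hDV hDV', hX.mono inter_subset_left,
      hu'.mono inter_subset_right⟩
  obtain ⟨K, hKD, hK, hu0⟩ := hu.compact_support
  have hfV := contDiffOn_of_graphMap b hX
  have hf : ∀ y ∈ D, ContDiffAt ℝ ∞ f y := fun y hy => hfV.contDiffAt (hV.mem_nhds (hDV hy))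
  have hua : ∀ y ∈ D, ContDiffAt ℝ ∞ u y := fun y hy => huV.contDiffAt (hV.mem_nhds (hDV hy))
  have hae := hS.domain.ae_eq_interior
  have hm : MeasurableSet (interior D) := isOpen_interior.measurableSet
  -- The boundary points in D form a null set, so all integrals may be taken over the interior.
  simp only [Qphi, setIntegral_congr_set hae, integrableOn_congr_set_ae hae]
  let I : E2 → ℝ := fun y => (‖grad (graphMap b f) u y‖ ^ 2 -
    normSqA (graphMap b f) N y * u y ^ 2) * weightedAreaDensity v (graphMap b f) y
  have hI : EqOn (graphEnergy b v f u) I (interior D) := fun y hy =>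
    (energy_eq_graphEnergy b (hf y (interior_subset hy))
      (inner_normal_graphMap b ((hf y (interior_subset hy)).differentiableAt (by simp))
        (hS.gauss.norm_eq_one y (interior_subset hy))
        (hS.gauss.normal y (interior_subset hy))).2.2).symm
  have hIint : IntegrableOn I (interior D) := by
    -- `graphEnergy` does not contain N and is smooth on a neighbourhood of D, hence bounded on K.
    refine IntegrableOn.congr_fun ?_ hI hm
    refine integrableOn_interior_of_continuousOn hK
      ((contDiffOn_graphEnergy b v hV hX huV).continuousOn.mono (hKD.trans hDV)) fun y hy => ?_
    have hpd : ∀ i, pd i u y = 0 := fun i => by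
      rw [pd, fderiv_eq_zero_of_notMem_compact hK hu0 hy]; rfl
    simp [graphEnergy, hpd, hu0 y ⟨interior_subset hy.1, hy.2⟩]
  have hA : ∀ i, SmoothNear D (angleFlux b v f u i) := fun i =>
    ⟨V, hV, hDV, contDiffOn_angleFlux b v hV hX huV i⟩
  have hE : ∀ i, SmoothNear D (energyFlux b v f u i) := fun i =>
    ⟨V, hV, hDV, contDiffOn_energyFlux b v hV hX huV i⟩
  have hA0 : ∀ i y, u y = 0 → angleFlux b v f u i y = 0 := fun i y h => by simp [angleFlux, h]
  have hE0 : ∀ i y, u y = 0 → energyFlux b v f u i y = 0 := fun i y h => by simp [energyFlux, h]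
  have hAint : IntegrableOn (fun y => ∑ i, pd i (angleFlux b v f u i) y) (interior D) :=
    integrable_finsetSum _ fun i _ =>
      integrableOn_pd hK hKD (hA i) (fun y hy => hA0 i y (hu0 y hy)) i
  have hEint : IntegrableOn (fun y => ∑ i, pd i (energyFlux b v f u i) y) (interior D) :=
    integrable_finsetSum _ fun i _ =>
      integrableOn_pd hK hKD (hE i) (fun y hy => hE0 i y (hu0 y hy)) i
  have hAzero : ∫ y in interior D, ∑ i, pd i (angleFlux b v f u i) y = 0 := by
    rw [integral_finsetSum _ fun i _ =>
      integrableOn_pd hK hKD (hA i) (fun y hy => hA0 i y (hu0 y hy)) i]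
    exact Finset.sum_eq_zero fun i _ => integral_pd_eq_zero hS.domain.boundary_null hK hKD (hA i)
      (fun y hy => hA0 i y (hu0 y hy)) (fun y hy => hA0 i y (hu.boundary y hy)) i
  have hEzero : ∫ y in interior D, ∑ i, pd i (energyFlux b v f u i) y = 0 := by
    rw [integral_finsetSum _ fun i _ =>
      integrableOn_pd hK hKD (hE i) (fun y hy => hE0 i y (hu0 y hy)) i]
    exact Finset.sum_eq_zero fun i _ => integral_pd_eq_zero hS.domain.boundary_null hK hKD (hE i)
      (fun y hy => hE0 i y (hu0 y hy)) (fun y hy => hE0 i y (hu.boundary y hy)) i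
  have hL : EqOn (fun y => ∑ i, pd i (energyFlux b v f u i) y - I y)
      (fun y => u y * stabilityOperator v (graphMap b f) N u y *
        weightedAreaDensity v (graphMap b f) y) (interior D) := fun y hy =>
    (energy_density_eq_divergence_sub b (hf y (interior_subset hy))
      (hua y (interior_subset hy))).symm
  refine ⟨(hEint.sub hIint).congr_fun hL hm, hIint, ?_, ?_⟩
  · rw [← setIntegral_congr_fun hm hL, integral_sub hEint hIint, hEzero, zero_sub, neg_neg]
  · rw [← hAzero]
    refine setIntegral_mono_on hAint hIint hm fun y hy => ?_
    obtain ⟨c, hc⟩ := hS.eventually_meanNumerator_eq hf hy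
    exact (divergence_angleFlux_le b (hf y (interior_subset hy)) (hua y (interior_subset hy))
      hc).trans_eq (hI hy)

end Stability

end LambdaSoliton

end

theorem theorem3p2 (v : LambdaSoliton.E3) (lam : ℝ) (D : Set LambdaSoliton.E2)
    (b : OrthonormalBasis (Fin 3) ℝ LambdaSoliton.E3) (f : LambdaSoliton.E2 → ℝ)
    (N : LambdaSoliton.E2 → LambdaSoliton.E3)
    (hS : LambdaSoliton.IsTranslatingSoliton v lam D (LambdaSoliton.graphMap b f) N) :
    LambdaSoliton.StronglyStable v D (LambdaSoliton.graphMap b f) N ∧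
    ∀ u : LambdaSoliton.E2 → ℝ, LambdaSoliton.IsTestFunction D u →
      MeasureTheory.IntegrableOn (fun y =>
        u y * LambdaSoliton.stabilityOperator v (LambdaSoliton.graphMap b f) N u y *
          LambdaSoliton.weightedAreaDensity v (LambdaSoliton.graphMap b f) y) D ∧
      MeasureTheory.IntegrableOn (fun y =>
        (‖LambdaSoliton.grad (LambdaSoliton.graphMap b f) u y‖ ^ 2 -
            LambdaSoliton.normSqA (LambdaSoliton.graphMap b f) N y * u y ^ 2) *
          LambdaSoliton.weightedAreaDensity v (LambdaSoliton.graphMap b f) y) D ∧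
      LambdaSoliton.Qphi v D (LambdaSoliton.graphMap b f) N u =
        ∫ y in D, (‖LambdaSoliton.grad (LambdaSoliton.graphMap b f) u y‖ ^ 2 -
            LambdaSoliton.normSqA (LambdaSoliton.graphMap b f) N y * u y ^ 2) *
          LambdaSoliton.weightedAreaDensity v (LambdaSoliton.graphMap b f) y ∧
      0 ≤ ∫ y in D, (‖LambdaSoliton.grad (LambdaSoliton.graphMap b f) u y‖ ^ 2 -
            LambdaSoliton.normSqA (LambdaSoliton.graphMap b f) N y * u y ^ 2) *
          LambdaSoliton.weightedAreaDensity v (LambdaSoliton.graphMap b f) y := by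
  refine ⟨fun u hu => ?_, fun u hu => hS.energy_identity_and_nonneg hu⟩
  obtain ⟨-, -, hQ, h0⟩ := hS.energy_identity_and_nonneg hu
  exact hQ.symm ▸ h0
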